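/- Let $\mathbb{C}_0=\{s\in\mathbb{C}: \operatorname{Re} s>0\}$, and let $\mathcal{A}^+$ be the Wiener–Dirichlet algebra, i.e. the algebra (under pointwise operations) of all functions $f:\mathbb{C}_0\to\mathbb{C}$ of the form $f(s)=\sum_{n=1}^\infty a_n n^{-s}$ with $\sum_{n=1}^\infty |a_n|<\infty$. Let $\varphi:\mathbb{C}_0\to\mathbb{C}_0$ be analytic. Then the composition operator $C_\varphi: f\mapsto f\circ\varphi$ maps $\mathcal{A}^+$ into itself and is an automorphism of the algebra $\mathcal{A}^+$ if and only if $\varphi$ is a vertical translation, that is, there is a real number $\tau$ such that $\varphi(s)=s+i\tau$ for all $s\in\mathbb{C}_0$. -/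

import Mathlib

/-- The open right half-plane `{s : 0 < Re s}`. -/
def rightHalfPlane : Set ℂ := {s | 0 < s.re}

/-- `f` is the sum, on the open right half-plane, of an absolutely convergent Dirichlet series
`∑_{n ≥ 1} a n * n ^ (-s)` with `∑ |a n| < ∞`. In Mathlib's `LSeries` the term of index `0` is `0`,
so that the value `a 0` plays no role. -/
def IsWienerDirichlet (f : rightHalfPlane → ℂ) : Prop :=
  ∃ a : ℕ → ℂ, Summable (fun n => ‖a n‖) ∧ ∀ s : rightHalfPlane, f s = LSeries a (s : ℂ)

theorem wienerDirichlet_lseriesSummable {a : ℕ → ℂ} (ha : Summable (fun n => ‖a n‖))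
    {s : ℂ} (hs : 0 ≤ s.re) : LSeriesSummable a s := by
  refine Summable.of_norm_bounded ha fun n => ?_
  rcases eq_or_ne n 0 with rfl | hn
  · simp
  · rw [LSeries.norm_term_eq, if_neg hn]
    exact div_le_self (norm_nonneg _)
      (Real.one_le_rpow (by exact_mod_cast Nat.one_le_iff_ne_zero.mpr hn) hs)

theorem IsWienerDirichlet.const (c : ℂ) : IsWienerDirichlet fun _ => c := by
  refine ⟨c • LSeries.delta, ?_, fun s => ?_⟩
  · refine summable_of_ne_finset_zero (s := {1}) fun n hn => ?_
    have : n ≠ 1 := by simpa using hn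
    simp [LSeries.delta, this]
  · rw [LSeries_smul, LSeries_delta]
    simp

theorem IsWienerDirichlet.add {f g : rightHalfPlane → ℂ} (hf : IsWienerDirichlet f)
    (hg : IsWienerDirichlet g) : IsWienerDirichlet (f + g) := by
  obtain ⟨a, ha, hfa⟩ := hf
  obtain ⟨b, hb, hgb⟩ := hg
  refine ⟨a + b, (ha.add hb).of_nonneg_of_le (fun _ => norm_nonneg _)
    (fun n => norm_add_le (a n) (b n)), fun s => ?_⟩
  have hs : 0 ≤ (s : ℂ).re := le_of_lt s.2
  rw [LSeries_add (wienerDirichlet_lseriesSummable ha hs) (wienerDirichlet_lseriesSummable hb hs),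
    Pi.add_apply, hfa, hgb]

theorem IsWienerDirichlet.mul {f g : rightHalfPlane → ℂ} (hf : IsWienerDirichlet f)
    (hg : IsWienerDirichlet g) : IsWienerDirichlet (f * g) := by
  obtain ⟨a, ha, hfa⟩ := hf
  obtain ⟨b, hb, hgb⟩ := hg
  refine ⟨LSeries.convolution a b, ?_, fun s => ?_⟩
  · have h := ((wienerDirichlet_lseriesSummable ha (s := 0) (by simp)).convolution
      (wienerDirichlet_lseriesSummable hb (s := 0) (by simp))).norm
    refine h.congr fun n => ?_
    rcases eq_or_ne n 0 with rfl | hn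
    · simp [LSeries.convolution_map_zero]
    · simp [LSeries.term_of_ne_zero hn]
  · have hs : 0 ≤ (s : ℂ).re := le_of_lt s.2
    rw [LSeries_convolution' (wienerDirichlet_lseriesSummable ha hs)
      (wienerDirichlet_lseriesSummable hb hs), Pi.mul_apply, hfa, hgb]

/-- The Wiener–Dirichlet algebra `𝒜⁺`, as an algebra of functions on the open right half-plane
(with pointwise operations). -/
def wienerDirichletAlgebra : Subalgebra ℂ (rightHalfPlane → ℂ) where
  carrier := {f | IsWienerDirichlet f}
  mul_mem' := IsWienerDirichlet.mul
  add_mem' := IsWienerDirichlet.add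
  algebraMap_mem' := IsWienerDirichlet.const

/-- The composition operator `C_φ : f ↦ f ∘ φ` with symbol `φ : ℂ₀ → ℂ₀` maps `𝒜⁺` into itself and
is an automorphism of the algebra `𝒜⁺`. -/
def CompositionIsAutomorphism (φ : rightHalfPlane → rightHalfPlane) : Prop :=
  ∃ T : wienerDirichletAlgebra ≃ₐ[ℂ] wienerDirichletAlgebra,
    ∀ f : wienerDirichletAlgebra, (T f : rightHalfPlane → ℂ) = (f : rightHalfPlane → ℂ) ∘ φ

/-!
Suppose `C_φ` is an automorphism. Then `2 ^ (-φ)` is a Dirichlet series `∑ a n * n ^ (-s)`, and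
there are `G`, `H` in `𝒜⁺` with `G ∘ φ = 2 ^ (-s)` and `H ∘ φ = 3 ^ (-s)`. Since
`1 - μ * 2 ^ (-s)` is invertible in `𝒜⁺` for `‖μ‖ < 1`, every character of `𝒜⁺` maps `2 ^ (-s)`
into the closed unit disc, whence `‖G‖ ≤ 1`.

The heart of the matter is `a 1 = 0`. As `‖2 ^ (-φ)‖ < 1`, Harnack's inequality gives
`‖a 1‖ < 1`. If `a 1 ≠ 0`, then `φ x` converges to a point `c` of the half-plane as `x → +∞`, and
the orders of vanishing of `G` and `H` at `c` would have the irrational ratio `log 2 / log 3`.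

Now the Phragmén–Lindelöf principle improves `‖2 ^ (-φ)‖ ≤ 1` to `‖2 ^ (-φ s)‖ ≤ 2 ^ (-Re s)`, that
is `Re s ≤ Re φ s`. In particular `Re φ x → +∞`, so the first coefficient of `G` vanishes too, and
the same principle for `G` gives `2 ^ (-Re s) = ‖G (φ s)‖ ≤ 2 ^ (-Re φ s)`. Hence `φ s - s` is
purely imaginary, and therefore constant.
-/

open Filter Topology

section HalfPlane

theorem isOpen_rightHalfPlane : IsOpen rightHalfPlane :=
  isOpen_lt continuous_const Complex.continuous_re

theorem ofReal_mem_rightHalfPlane {x : ℝ} (hx : 0 < x) : (x : ℂ) ∈ rightHalfPlane := by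
  simpa [rightHalfPlane] using hx

theorem isConnected_rightHalfPlane : IsConnected rightHalfPlane :=
  (convex_halfSpace_re_gt 0).isConnected ⟨(1 : ℝ), ofReal_mem_rightHalfPlane one_pos⟩

theorem eventually_ofReal_mem_rightHalfPlane : ∀ᶠ x : ℝ in atTop, (x : ℂ) ∈ rightHalfPlane :=
  (eventually_gt_atTop 0).mono fun _ hx => ofReal_mem_rightHalfPlane hx

theorem norm_le_norm_center_mul_of_re_nonneg {g : ℂ → ℂ} {c z : ℂ} {R : ℝ}
    (hg : DifferentiableOn ℂ g (Metric.ball c R)) (hre : ∀ w ∈ Metric.ball c R, 0 ≤ (g w).re)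
    (hz : z ∈ Metric.ball c R) : ‖g z‖ ≤ ‖g c‖ * (R + dist z c) / (R - dist z c) := by
  have hR : 0 < R := Metric.pos_of_mem_ball hz
  have hshift : Set.MapsTo (fun w => c + w) (Metric.ball 0 R) (Metric.ball c R) := fun w hw => by
    simpa using hw
  have hbound : ∀ M > 0, ‖g z‖ ≤
      2 * M * dist z c / (R - dist z c) + ‖g c‖ * (R + dist z c) / (R - dist z c) := fun M hM => by
    have h := Complex.borelCaratheodory (f := fun w => -g (c + w)) (z := z - c) hM
      (hg.comp (by fun_prop) hshift).neg
      (fun w hw => by simpa using (neg_nonpos.2 (hre _ (hshift hw))).trans hM.le) hR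
      (by simpa [dist_eq_norm] using hz)
    simpa [dist_eq_norm] using h
  have hlim : Tendsto (fun M : ℝ =>
      2 * M * dist z c / (R - dist z c) + ‖g c‖ * (R + dist z c) / (R - dist z c))
      (𝓝[>] 0) (𝓝 (‖g c‖ * (R + dist z c) / (R - dist z c))) :=
    (Continuous.tendsto' (by fun_prop) _ _ (by simp)).mono_left nhdsWithin_le_nhds
  exact ge_of_tendsto hlim (eventually_mem_nhdsWithin.mono hbound)

theorem eq_zero_of_re_nonneg_of_tendsto_mul {g : ℂ → ℂ} (hg : DifferentiableOn ℂ g rightHalfPlane)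
    (hre : ∀ s ∈ rightHalfPlane, 0 ≤ (g s).re)
    (hlim : Tendsto (fun x : ℝ => x * ‖g x‖) atTop (𝓝 0)) : g 1 = 0 := by
  have hball : ∀ x : ℝ, Metric.ball (x : ℂ) x ⊆ rightHalfPlane := fun x w hw => by
    have h := (Complex.abs_re_le_norm (w - x)).trans_lt (mem_ball_iff_norm.1 hw)
    rw [Complex.sub_re, Complex.ofReal_re, abs_lt] at h
    exact (by linarith : 0 < w.re)
  have hle : ∀ᶠ x : ℝ in atTop, ‖g 1‖ ≤ 2 * (x * ‖g x‖) := by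
    filter_upwards [eventually_gt_atTop 1] with x hx
    have hdist : dist (1 : ℂ) x = x - 1 := by
      rw [dist_comm, dist_eq_norm, ← Complex.ofReal_one, ← Complex.ofReal_sub, Complex.norm_real,
        Real.norm_of_nonneg (by linarith)]
    have h := norm_le_norm_center_mul_of_re_nonneg (hg.mono (hball x))
      (fun w hw => hre w (hball x hw)) (Metric.mem_ball.2 (by rw [hdist]; linarith))
    rw [hdist, sub_sub_cancel, div_one] at h
    nlinarith [norm_nonneg (g x)]
  refine norm_le_zero_iff.1 (ge_of_tendsto ?_ hle)
  simpa using hlim.const_mul 2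

theorem norm_lt_one_of_tendsto_mul_norm_sub {F : ℂ → ℂ} {l : ℂ}
    (hF : DifferentiableOn ℂ F rightHalfPlane) (hF1 : ∀ s ∈ rightHalfPlane, ‖F s‖ < 1)
    (hlim : Tendsto (fun x : ℝ => x * ‖F x - l‖) atTop (𝓝 0)) : ‖l‖ < 1 := by
  have hl : Tendsto (fun x : ℝ => F x) atTop (𝓝 l) := by
    refine tendsto_iff_norm_sub_tendsto_zero.2 ?_
    have h := tendsto_inv_atTop_zero.mul hlim
    rw [zero_mul] at h
    refine h.congr' ((eventually_ne_atTop 0).mono fun x hx => ?_)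
    exact inv_mul_cancel_left₀ hx _
  refine lt_of_le_of_ne (le_of_tendsto hl.norm
    (eventually_ofReal_mem_rightHalfPlane.mono fun x hx => (hF1 x hx).le)) fun h1 => ?_
  have hpos : ∀ s ∈ rightHalfPlane, 0 < (1 - starRingEnd ℂ l * F s).re := fun s hs => by
    have h := (Complex.re_le_norm (starRingEnd ℂ l * F s)).trans_lt
      (by simpa [h1] using hF1 s hs)
    simpa using h
  have hnorm : ∀ s, ‖1 - starRingEnd ℂ l * F s‖ = ‖F s - l‖ := fun s => by
    have h : 1 - starRingEnd ℂ l * F s = starRingEnd ℂ l * (l - F s) := by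
      rw [mul_sub, Complex.conj_mul', h1]; simp
    rw [h, norm_mul, RCLike.norm_conj, h1, one_mul, norm_sub_rev]
  have hzero := eq_zero_of_re_nonneg_of_tendsto_mul (g := fun s => 1 - starRingEnd ℂ l * F s)
    ((hF.const_mul _).const_sub 1) (fun s hs => (hpos s hs).le) (by simpa only [hnorm] using hlim)
  have h := hpos 1 (by simp [rightHalfPlane])
  simp [hzero] at h

theorem norm_le_of_bounded_of_norm_mul_I_le {f : ℂ → ℂ} {B M : ℝ}
    (hf : ∀ z : ℂ, 0 ≤ z.re → DifferentiableAt ℂ f z) (hB : ∀ z : ℂ, 0 ≤ z.re → ‖f z‖ ≤ B)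
    (hM : ∀ y : ℝ, ‖f (y * Complex.I)‖ ≤ M) {z : ℂ} (hz : 0 ≤ z.re) : ‖f z‖ ≤ M := by
  refine PhragmenLindelof.right_half_plane_of_bounded_on_real ?_ ⟨0, two_pos, 0, ?_⟩ ?_ hM hz
  · refine DifferentiableOn.diffContOnCl fun w hw => ?_
    rw [Complex.closure_setOfPred_lt_re] at hw
    exact (hf w hw).differentiableWithinAt
  · refine Asymptotics.IsBigO.of_bound B (eventually_inf_principal.2
      (Eventually.of_forall fun w hw => ?_))
    simpa only [zero_mul, Real.exp_zero, norm_one, mul_one] using hB w (le_of_lt hw)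
  · exact isBoundedUnder_of_eventually_le
      ((eventually_ge_atTop 0).mono fun x hx => hB x (by simpa using hx))

theorem norm_le_mul_rpow_neg_re {f : ℂ → ℂ} (hf : DifferentiableOn ℂ f rightHalfPlane) {b M C : ℝ}
    (hb : 0 < b) (hM : ∀ s ∈ rightHalfPlane, ‖f s‖ ≤ M)
    (hC : ∀ s ∈ rightHalfPlane, ‖f s‖ ≤ C * b ^ (-s.re)) {s : ℂ} (hs : s ∈ rightHalfPlane) :
    ‖f s‖ ≤ M * b ^ (-s.re) := by
  have hb0 : (b : ℂ) ≠ 0 := by exact_mod_cast hb.ne'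
  have hmem : ∀ {ε : ℝ} {z : ℂ}, 0 < ε → 0 ≤ z.re → z + ε ∈ rightHalfPlane := fun hε hz => by
    simpa [rightHalfPlane] using add_pos_of_nonneg_of_pos hz hε
  -- `f` need not extend to the imaginary axis, so it is first translated by `ε`.
  have hshift : ∀ ε : ℝ, 0 < ε → ∀ z : ℂ, 0 ≤ z.re → ‖(b : ℂ) ^ z * f (z + ε)‖ ≤ M := by
    intro ε hε z hz
    refine norm_le_of_bounded_of_norm_mul_I_le (f := fun z => (b : ℂ) ^ z * f (z + ε))
      (B := C * b ^ (-ε)) (fun z hz => ?_) (fun z hz => ?_) (fun y => ?_) hz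
    · exact (differentiableAt_id.const_cpow (Or.inl hb0)).mul
        ((hf.differentiableAt (isOpen_rightHalfPlane.mem_nhds (hmem hε hz))).comp z (by fun_prop))
    · rw [norm_mul, Complex.norm_cpow_eq_rpow_re_of_pos hb]
      calc b ^ z.re * ‖f (z + ε)‖ ≤ b ^ z.re * (C * b ^ (-(z + ε).re)) := by
            gcongr; exact hC _ (hmem hε hz)
        _ = C * (b ^ z.re * b ^ (-(z + ε).re)) := by ring
        _ = C * b ^ (-ε) := by rw [← Real.rpow_add hb]; simp
    · simpa [Complex.norm_cpow_eq_rpow_re_of_pos hb] using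
        hM _ (hmem (z := y * Complex.I) hε (by simp))
  have hle : ∀ᶠ ε : ℝ in 𝓝[>] 0, ‖f s‖ ≤ M * b ^ (-(s.re - ε)) := by
    filter_upwards [Ioo_mem_nhdsGT (show 0 < s.re from hs)] with ε hε
    have h := hshift ε hε.1 (s - ε) (by simpa using hε.2.le)
    rw [sub_add_cancel, norm_mul, Complex.norm_cpow_eq_rpow_re_of_pos hb, mul_comm,
      ← le_div_iff₀ (Real.rpow_pos_of_pos hb _), div_eq_mul_inv, ← Real.rpow_neg hb.le] at h
    simpa using h
  have hcont : Continuous fun ε : ℝ => M * b ^ (-(s.re - ε)) :=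
    continuous_const.mul ((Real.continuous_const_rpow hb.ne').comp (by fun_prop))
  exact ge_of_tendsto ((hcont.tendsto' 0 _ (by simp)).mono_left nhdsWithin_le_nhds) hle

theorem exists_eq_add_I_mul_of_re_eq {φ : ℂ → ℂ} (hφ : AnalyticOnNhd ℂ φ rightHalfPlane)
    (hre : ∀ s ∈ rightHalfPlane, (φ s).re = s.re) :
    ∃ τ : ℝ, ∀ s ∈ rightHalfPlane, φ s = s + Complex.I * τ := by
  obtain ⟨τ, hτ⟩ := (hφ.sub analyticOnNhd_id).eq_re_add_const_mul_I_of_re_eq_const (c₀ := 0)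
    (fun s hs => by simp [hre s hs]) isOpen_rightHalfPlane isConnected_rightHalfPlane
  refine ⟨τ, fun s hs => ?_⟩
  have h : φ s - s = 0 + τ * Complex.I := by exact_mod_cast hτ s hs
  linear_combination h

end HalfPlane

section LocalBehaviour

theorem exists_tendsto_of_tendsto_exp {g : ℝ → ℂ} {a : ℂ}
    (hg : ∀ᶠ x in atTop, ContinuousAt g x)
    (hexp : Tendsto (fun x => Complex.exp (g x)) atTop (𝓝 a)) (ha : a ≠ 0) :
    ∃ c, Complex.exp c = a ∧ Tendsto g atTop (𝓝 c) := by
  have hlim : Tendsto (fun x => Complex.exp (g x) / a) atTop (𝓝 1) := by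
    simpa [ha] using hexp.div_const a
  obtain ⟨X, hX⟩ := eventually_atTop.1 (hg.and
    (hlim.eventually (Complex.isOpen_slitPlane.mem_nhds Complex.one_mem_slitPlane)))
  let U : ℝ → ℂ := fun x => g x - Complex.log (Complex.exp (g x) / a)
  have hUexp : ∀ x, Complex.exp (U x) = a := fun x => by
    rw [Complex.exp_sub, Complex.exp_log (div_ne_zero (Complex.exp_ne_zero _) ha),
      div_div_cancel₀ (Complex.exp_ne_zero _)]
  have hUcont : ContinuousOn U (Set.Ici X) := fun x hx =>
    ((hX x hx).1.sub (((hX x hx).1.cexp.div_const a).clog (hX x hx).2)).continuousWithinAt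
  have hUconst : ∀ x ∈ Set.Ici X, U x = U X := fun x hx =>
    Complex.isCoveringMap_exp.constOn_of_comp isPreconnected_Ici hUcont
      (fun y _ y' _ => Subtype.ext ((hUexp y).trans (hUexp y').symm)) hx Set.self_mem_Ici
  refine ⟨U X, hUexp X, ?_⟩
  have hUlim : Tendsto (fun x => U X + Complex.log (Complex.exp (g x) / a)) atTop (𝓝 (U X)) := by
    simpa using (hlim.clog Complex.one_mem_slitPlane).const_add (U X)
  refine hUlim.congr' ((eventually_ge_atTop X).mono fun x hx => ?_)
  rw [← hUconst x hx, sub_add_cancel]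

theorem tendsto_log_norm_div_log_norm_sub {f : ℂ → ℂ} {c : ℂ} (hf : AnalyticAt ℂ f c)
    (hord : analyticOrderAt f c ≠ ⊤) :
    Tendsto (fun z => Real.log ‖f z‖ / Real.log ‖z - c‖) (𝓝[≠] c)
      (𝓝 (analyticOrderNatAt f c)) := by
  obtain ⟨g, hg, hgc, hfg⟩ := hf.analyticOrderAt_ne_top.1 hord
  have hlog : Tendsto (fun z => Real.log ‖z - c‖) (𝓝[≠] c) atBot :=
    Real.tendsto_log_nhdsGT_zero.comp (tendsto_norm_sub_self_nhdsNE c)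
  have hglog : Tendsto (fun z => Real.log ‖g z‖ / Real.log ‖z - c‖) (𝓝[≠] c) (𝓝 0) :=
    ((hg.continuousAt.norm.log (norm_ne_zero_iff.2 hgc)).tendsto.mono_left
      nhdsWithin_le_nhds).div_atBot hlog
  have hsum := hglog.const_add (analyticOrderNatAt f c : ℝ)
  rw [add_zero] at hsum
  refine hsum.congr' ?_
  filter_upwards [eventually_mem_nhdsWithin, nhdsWithin_le_nhds hfg,
    nhdsWithin_le_nhds (hg.continuousAt.eventually_ne hgc), hlog.eventually_ne_atBot 0]
    with z hz hfz hgz hlogz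
  rw [hfz, norm_smul, norm_pow, Real.log_mul (pow_ne_zero _ (norm_ne_zero_iff.2 (sub_ne_zero.2 hz)))
    (norm_ne_zero_iff.2 hgz), Real.log_pow, add_div, mul_div_cancel_right₀ _ hlogz]

theorem natCast_mul_log_ne_natCast_mul_log {p q m k : ℕ} (hq : 1 < q) (hpq : p.Coprime q)
    (hm : m ≠ 0) : (m : ℝ) * Real.log q ≠ k * Real.log p := by
  intro h
  have hp : p ≠ 0 := by
    rintro rfl
    exact hq.ne' (Nat.coprime_zero_left q |>.1 hpq)
  rw [← Real.log_pow, ← Real.log_pow] at h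
  have hpow : q ^ m = p ^ k := by
    exact_mod_cast Real.log_injOn_pos (Set.mem_Ioi.2 (by positivity))
      (Set.mem_Ioi.2 (by positivity)) h
  have hone : q ^ m = 1 := (Nat.coprime_self _).1 (by
    nth_rw 1 [hpow]
    exact hpq.pow k m)
  exact hq.ne' ((Nat.pow_eq_one.1 hone).resolve_right hm)

theorem norm_natCast_cpow_neg_ofReal {n : ℕ} (hn : 0 < n) (x : ℝ) :
    ‖(n : ℂ) ^ (-(x : ℂ))‖ = (n : ℝ) ^ (-x) := by
  simpa using Complex.norm_natCast_cpow_of_pos hn (-(x : ℂ))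

theorem tendsto_natCast_cpow_neg_ofReal {n : ℕ} (hn : 1 < n) :
    Tendsto (fun x : ℝ => (n : ℂ) ^ (-(x : ℂ))) atTop (𝓝 0) := by
  refine tendsto_zero_iff_norm_tendsto_zero.2 ?_
  simp only [norm_natCast_cpow_neg_ofReal (zero_lt_one.trans hn)]
  exact (tendsto_rpow_atBot_of_base_gt_one n (by exact_mod_cast hn)).comp tendsto_neg_atTop_atBot

theorem tendsto_mul_log_div_log_norm_sub_of_comp_eq {u : ℝ → ℂ} {F : ℂ → ℂ} {c : ℂ} {n : ℕ}
    (hFa : AnalyticAt ℂ F c) (hn : 1 < n) (hu : Tendsto u atTop (𝓝 c))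
    (hF : ∀ᶠ x : ℝ in atTop, F (u x) = (n : ℂ) ^ (-(x : ℂ))) :
    analyticOrderNatAt F c ≠ 0 ∧
      Tendsto (fun x => -x * Real.log n / Real.log ‖u x - c‖) atTop
        (𝓝 (analyticOrderNatAt F c)) := by
  have hFu : ∀ᶠ x in atTop, F (u x) ≠ 0 := hF.mono fun x hx => by
    simp [hx, Complex.cpow_eq_zero_iff, (zero_lt_one.trans hn).ne']
  have hFc : F c = 0 := tendsto_nhds_unique ((hFa.continuousAt.tendsto.comp hu).congr' hF)
    (tendsto_natCast_cpow_neg_ofReal hn)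
  have hu' : Tendsto u atTop (𝓝[≠] c) :=
    tendsto_nhdsWithin_iff.2 ⟨hu, hFu.mono fun x hx hxc => hx (by rw [hxc, hFc])⟩
  have htop : analyticOrderAt F c ≠ ⊤ := fun h => by
    obtain ⟨x, hx, hx0⟩ := (hFu.and (hu.eventually (analyticOrderAt_eq_top.1 h))).exists
    exact hx hx0
  have hne : analyticOrderNatAt F c ≠ 0 := by
    have h := hFa.analyticOrderAt_ne_zero.2 hFc
    rw [← Nat.cast_analyticOrderNatAt htop] at h
    exact_mod_cast h
  refine ⟨hne, ((tendsto_log_norm_div_log_norm_sub hFa htop).comp hu').congr' ?_⟩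
  filter_upwards [hF] with x hx
  rw [Function.comp, hx, norm_natCast_cpow_neg_ofReal (zero_lt_one.trans hn),
    Real.log_rpow (by exact_mod_cast zero_lt_one.trans hn)]

theorem not_tendsto_nhds_of_comp_eq_natCast_cpow_neg {u : ℝ → ℂ} {G H : ℂ → ℂ} {c : ℂ} {p q : ℕ}
    (hGa : AnalyticAt ℂ G c) (hHa : AnalyticAt ℂ H c) (hp : 1 < p) (hq : 1 < q)
    (hpq : p.Coprime q) (hG : ∀ᶠ x : ℝ in atTop, G (u x) = (p : ℂ) ^ (-(x : ℂ)))
    (hH : ∀ᶠ x : ℝ in atTop, H (u x) = (q : ℂ) ^ (-(x : ℂ))) : ¬ Tendsto u atTop (𝓝 c) := by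
  intro hu
  obtain ⟨hm, hGlim⟩ := tendsto_mul_log_div_log_norm_sub_of_comp_eq hGa hp hu hG
  obtain ⟨-, hHlim⟩ := tendsto_mul_log_div_log_norm_sub_of_comp_eq hHa hq hu hH
  refine natCast_mul_log_ne_natCast_mul_log (k := analyticOrderNatAt H c) hq hpq hm
    (tendsto_nhds_unique (hGlim.mul_const _) ((hHlim.mul_const _).congr fun x => ?_))
  ring

end LocalBehaviour

section WienerDirichletSeries

variable {a : ℕ → ℂ}

theorem analyticOnNhd_LSeries_rightHalfPlane (ha : Summable fun n => ‖a n‖) :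
    AnalyticOnNhd ℂ (LSeries a) rightHalfPlane := by
  have habs : LSeries.abscissaOfAbsConv a ≤ 0 := by
    simpa using (wienerDirichlet_lseriesSummable ha (s := 0) le_rfl).abscissaOfAbsConv_le
  exact (LSeries_analyticOnNhd a).mono fun s hs => habs.trans_lt (by exact_mod_cast hs)

theorem norm_LSeries_sub_coeff_one_le (ha : Summable fun n => ‖a n‖) {s : ℂ} (hs : 0 ≤ s.re) :
    ‖LSeries a s - a 1‖ ≤ (∑' n, ‖a n‖) * (2 : ℝ) ^ (-s.re) := by
  have hsum := (wienerDirichlet_lseriesSummable ha hs).tsum_eq_add_tsum_ite 1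
  rw [LSeries.term_of_ne_zero one_ne_zero, Nat.cast_one, Complex.one_cpow, div_one] at hsum
  rw [LSeries, hsum, add_sub_cancel_left]
  refine tsum_of_norm_bounded (ha.hasSum.mul_right _) fun n => ?_
  split_ifs with hn
  · rw [norm_zero]; positivity
  rcases eq_or_ne n 0 with rfl | hn0
  · rw [LSeries.term_zero, norm_zero]; positivity
  rw [LSeries.norm_term_eq, if_neg hn0, Real.rpow_neg two_pos.le, div_eq_mul_inv]
  have hn2 : (2 : ℝ) ≤ n := by exact_mod_cast (by omega : 2 ≤ n)
  gcongr

theorem tendsto_LSeries_coeff_one {ι : Type*} {l : Filter ι} {u : ι → ℂ}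
    (ha : Summable fun n => ‖a n‖) (hu : Tendsto (fun i => (u i).re) l atTop) :
    Tendsto (fun i => LSeries a (u i)) l (𝓝 (a 1)) := by
  have hpow := ((tendsto_rpow_atBot_of_base_gt_one 2 one_lt_two).comp
    (tendsto_neg_atTop_atBot.comp hu)).const_mul (∑' n, ‖a n‖)
  rw [mul_zero] at hpow
  exact tendsto_iff_norm_sub_tendsto_zero.2 (squeeze_zero' (Eventually.of_forall fun _ =>
    norm_nonneg _) ((hu.eventually_ge_atTop 0).mono fun i hi =>
      norm_LSeries_sub_coeff_one_le ha hi) hpow)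

theorem tendsto_mul_norm_LSeries_sub_coeff_one (ha : Summable fun n => ‖a n‖) :
    Tendsto (fun x : ℝ => x * ‖LSeries a x - a 1‖) atTop (𝓝 0) := by
  have hdecay : Tendsto (fun x : ℝ => (∑' n, ‖a n‖) * (x * (2 : ℝ) ^ (-x))) atTop (𝓝 0) := by
    have h := (tendsto_rpow_mul_exp_neg_mul_atTop_nhds_zero 1 (Real.log 2)
      (Real.log_pos one_lt_two)).const_mul (∑' n, ‖a n‖)
    simpa only [Real.rpow_one, mul_zero, neg_mul, ← mul_neg,
      ← Real.rpow_def_of_pos (two_pos : (0 : ℝ) < 2)] using h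
  refine squeeze_zero' ((eventually_ge_atTop 0).mono fun x hx => by positivity)
    ((eventually_ge_atTop 0).mono fun x hx => ?_) hdecay
  rw [mul_left_comm]
  gcongr
  exact norm_LSeries_sub_coeff_one_le ha hx

theorem norm_LSeries_le_mul_two_rpow_neg_re (ha : Summable fun n => ‖a n‖) (h1 : a 1 = 0) {M : ℝ}
    (hM : ∀ s ∈ rightHalfPlane, ‖LSeries a s‖ ≤ M) {s : ℂ} (hs : s ∈ rightHalfPlane) :
    ‖LSeries a s‖ ≤ M * (2 : ℝ) ^ (-s.re) :=
  norm_le_mul_rpow_neg_re (analyticOnNhd_LSeries_rightHalfPlane ha).differentiableOn two_pos hM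
    (fun z hz => by simpa [h1] using norm_LSeries_sub_coeff_one_le ha (le_of_lt hz)) hs

theorem LSeries_mul_cpow_neg (a : ℕ → ℂ) (c s : ℂ) :
    LSeries (fun n => a n * (n : ℂ) ^ (-c)) s = LSeries a (s + c) := by
  refine tsum_congr fun n => ?_
  rcases eq_or_ne n 0 with rfl | hn
  · simp only [LSeries.term_zero]
  · rw [LSeries.term_of_ne_zero hn, LSeries.term_of_ne_zero hn, add_comm s,
      Complex.cpow_add _ _ (Nat.cast_ne_zero.2 hn), Complex.cpow_neg, ← div_eq_mul_inv, div_div]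

theorem IsWienerDirichlet.tsum {ι : Type*} {e : ι → ℕ} (he : Function.Injective e)
    {c : ι → ℂ} (hc : Summable fun i => ‖c i‖) :
    IsWienerDirichlet fun s => ∑' i, c i * (e i : ℂ) ^ (-(s : ℂ)) := by
  have hsupp : ∀ n ∉ Set.range e, Function.extend e c 0 n = 0 := fun n hn =>
    Function.extend_apply' _ _ _ hn
  refine ⟨Function.extend e c 0, ?_, fun s => ?_⟩
  · refine (he.summable_iff fun n hn => by rw [hsupp n hn, norm_zero]).1 ?_
    simpa only [Function.comp_def, he.extend_apply] using hc
  · rw [LSeries, ← he.tsum_eq]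
    · refine tsum_congr fun i => ?_
      rcases eq_or_ne (e i) 0 with hi | hi
      · have hs0 : (s : ℂ) ≠ 0 := fun h => (show 0 < (s : ℂ).re from s.2).ne' (by simp [h])
        simp [hi, hs0]
      · rw [LSeries.term_of_ne_zero hi, he.extend_apply, Complex.cpow_neg, div_eq_mul_inv]
    · refine Function.support_subset_iff'.2 fun n hn => ?_
      simp [LSeries.term_def, hsupp n hn]

end WienerDirichletSeries

section Characters

/-- The function `s ↦ n ^ (-s)` as an element of `𝒜⁺`; the functions with `n = 2` and `n = 3`
determine `φ` from its composition operator. -/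
noncomputable def natCastCpowNeg (n : ℕ) : wienerDirichletAlgebra :=
  ⟨fun s => (n : ℂ) ^ (-(s : ℂ)), show IsWienerDirichlet _ by
    simpa using IsWienerDirichlet.tsum (e := fun _ : Unit => n) (c := fun _ => 1)
      (Function.injective_of_subsingleton _) Summable.of_finite⟩

variable {n : ℕ}

theorem norm_natCast_cpow_neg_lt_one (hn : 1 < n) {s : ℂ} (hs : s ∈ rightHalfPlane) :
    ‖(n : ℂ) ^ (-s)‖ < 1 := by
  rw [Complex.norm_natCast_cpow_of_pos (zero_lt_one.trans hn)]
  exact Real.rpow_lt_one_of_one_lt_of_neg (by exact_mod_cast hn)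
    (by simpa [rightHalfPlane] using hs)

theorem isUnit_one_sub_smul_natCastCpowNeg (hn : 1 < n) {μ : ℂ} (hμ : ‖μ‖ < 1) :
    IsUnit (1 - μ • natCastCpowNeg n) := by
  have hlt : ∀ s : rightHalfPlane, ‖μ * (n : ℂ) ^ (-(s : ℂ))‖ < 1 := fun s => by
    rw [norm_mul]
    exact mul_lt_one_of_nonneg_of_lt_one_left (norm_nonneg _) hμ
      (norm_natCast_cpow_neg_lt_one hn s.2).le
  have hinv : IsWienerDirichlet fun s => ∑' k : ℕ, μ ^ k * ((n ^ k : ℕ) : ℂ) ^ (-(s : ℂ)) :=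
    .tsum (Nat.pow_right_injective hn)
      (by simpa only [norm_pow] using summable_geometric_of_lt_one (norm_nonneg μ) hμ)
  refine IsUnit.of_mul_eq_one ⟨_, hinv⟩ (Subtype.ext (funext fun s => ?_))
  have hgeom : ∑' k : ℕ, μ ^ k * ((n ^ k : ℕ) : ℂ) ^ (-(s : ℂ)) =
      (1 - μ * (n : ℂ) ^ (-(s : ℂ)))⁻¹ := by
    rw [← tsum_geometric_of_norm_lt_one (hlt s)]
    refine tsum_congr fun k => ?_
    rw [mul_pow, ← Complex.cpow_nat_mul, Nat.cast_pow, Complex.natCast_cpow_natCast_mul]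
  have hne : 1 - μ * (n : ℂ) ^ (-(s : ℂ)) ≠ 0 := sub_ne_zero.2 fun h => by
    simpa [← h] using hlt s
  change (1 - μ * (n : ℂ) ^ (-(s : ℂ))) * ∑' k : ℕ, μ ^ k * ((n ^ k : ℕ) : ℂ) ^ (-(s : ℂ)) = 1
  rw [hgeom, mul_inv_cancel₀ hne]

theorem norm_algHom_natCastCpowNeg_le_one (hn : 1 < n) (χ : wienerDirichletAlgebra →ₐ[ℂ] ℂ) :
    ‖χ (natCastCpowNeg n)‖ ≤ 1 := by
  by_contra! h
  have h0 : χ (natCastCpowNeg n) ≠ 0 := norm_pos_iff.1 (zero_lt_one.trans h)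
  have hunit := (isUnit_one_sub_smul_natCastCpowNeg hn
    (μ := (χ (natCastCpowNeg n))⁻¹) (by rw [norm_inv]; exact inv_lt_one_of_one_lt₀ h)).map χ
  simp [h0] at hunit

end Characters

section Symbol

theorem eq_zero_of_tendsto_two_cpow_neg {φ G H : ℂ → ℂ} {p q : ℕ} {l : ℂ}
    (hφ : ContinuousOn φ rightHalfPlane) (hGa : AnalyticOnNhd ℂ G rightHalfPlane)
    (hHa : AnalyticOnNhd ℂ H rightHalfPlane) (hp : 1 < p) (hq : 1 < q) (hpq : p.Coprime q)
    (hG : ∀ s ∈ rightHalfPlane, G (φ s) = (p : ℂ) ^ (-s))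
    (hH : ∀ s ∈ rightHalfPlane, H (φ s) = (q : ℂ) ^ (-s)) (hl : ‖l‖ < 1)
    (hlim : Tendsto (fun x : ℝ => (2 : ℂ) ^ (-φ x)) atTop (𝓝 l)) : l = 0 := by
  by_contra hl0
  have hlog : Complex.log 2 = (Real.log 2 : ℝ) := by simp
  have hlog0 : Complex.log 2 ≠ 0 := by
    rw [hlog]
    exact_mod_cast (Real.log_pos one_lt_two).ne'
  simp only [Complex.cpow_def_of_ne_zero (two_ne_zero : (2 : ℂ) ≠ 0)] at hlim
  have hcont : ∀ᶠ x : ℝ in atTop, ContinuousAt (fun x : ℝ => Complex.log 2 * -φ x) x :=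
    eventually_ofReal_mem_rightHalfPlane.mono fun x hx =>
      (((hφ.continuousAt (isOpen_rightHalfPlane.mem_nhds hx)).comp
        Complex.continuous_ofReal.continuousAt).neg.const_mul _)
  obtain ⟨c, rfl, hc⟩ := exists_tendsto_of_tendsto_exp hcont hlim hl0
  have hφlim : Tendsto (fun x : ℝ => φ x) atTop (𝓝 (-(c / Complex.log 2))) :=
    (hc.div_const (Complex.log 2)).neg.congr fun x => by
      rw [mul_div_cancel_left₀ _ hlog0, neg_neg]
  have hmem : -(c / Complex.log 2) ∈ rightHalfPlane := by
    have hcre : c.re < 0 := by simpa [Complex.norm_exp] using hl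
    change 0 < (-(c / Complex.log 2)).re
    rw [hlog, Complex.neg_re, Complex.div_ofReal_re]
    exact neg_pos.2 (div_neg_of_neg_of_pos hcre (Real.log_pos one_lt_two))
  exact not_tendsto_nhds_of_comp_eq_natCast_cpow_neg (hGa _ hmem) (hHa _ hmem) hp hq hpq
    (eventually_ofReal_mem_rightHalfPlane.mono fun x hx => hG x hx)
    (eventually_ofReal_mem_rightHalfPlane.mono fun x hx => hH x hx) hφlim

variable {φ : ℂ → ℂ} {a b : ℕ → ℂ}

theorem re_le_re_of_two_cpow_neg_eq_LSeries (hmaps : Set.MapsTo φ rightHalfPlane rightHalfPlane)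
    (ha : Summable fun n => ‖a n‖) (h1 : a 1 = 0)
    (hser : ∀ s ∈ rightHalfPlane, (2 : ℂ) ^ (-φ s) = LSeries a s) {s : ℂ}
    (hs : s ∈ rightHalfPlane) : s.re ≤ (φ s).re := by
  have h := norm_LSeries_le_mul_two_rpow_neg_re ha h1 (M := 1) (fun z hz => by
    rw [← hser z hz]
    exact_mod_cast (norm_natCast_cpow_neg_lt_one one_lt_two (hmaps hz)).le) hs
  rw [← hser s hs, one_mul, ← Complex.ofReal_ofNat, Complex.norm_cpow_eq_rpow_re_of_pos two_pos,
    Real.rpow_le_rpow_left_iff one_lt_two, Complex.neg_re] at h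
  exact neg_le_neg_iff.1 h

theorem re_le_re_of_LSeries_comp_eq_two_cpow_neg
    (hmaps : Set.MapsTo φ rightHalfPlane rightHalfPlane) (hb : Summable fun n => ‖b n‖)
    (hb1 : ∀ s ∈ rightHalfPlane, ‖LSeries b s‖ ≤ 1)
    (hcomp : ∀ s ∈ rightHalfPlane, LSeries b (φ s) = (2 : ℂ) ^ (-s))
    (hle : ∀ s ∈ rightHalfPlane, s.re ≤ (φ s).re) {s : ℂ} (hs : s ∈ rightHalfPlane) :
    (φ s).re ≤ s.re := by
  have hre : Tendsto (fun x : ℝ => (φ x).re) atTop atTop :=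
    tendsto_atTop_mono' _ (eventually_ofReal_mem_rightHalfPlane.mono fun x hx => by
      simpa using hle x hx) tendsto_id
  have h1 : b 1 = 0 := tendsto_nhds_unique ((tendsto_LSeries_coeff_one hb hre).congr'
    (eventually_ofReal_mem_rightHalfPlane.mono fun x hx => hcomp x hx))
    (by exact_mod_cast tendsto_natCast_cpow_neg_ofReal one_lt_two)
  have h := norm_LSeries_le_mul_two_rpow_neg_re hb h1 hb1 (hmaps hs)
  rw [hcomp s hs, one_mul, ← Complex.ofReal_ofNat, Complex.norm_cpow_eq_rpow_re_of_pos two_pos,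
    Real.rpow_le_rpow_left_iff one_lt_two, Complex.neg_re] at h
  exact neg_le_neg_iff.1 h

end Symbol

section CompositionOperator

theorem IsWienerDirichlet.comp_translation {f : rightHalfPlane → ℂ} (hf : IsWienerDirichlet f)
    {φ : rightHalfPlane → rightHalfPlane} {τ : ℝ}
    (hφ : ∀ s, (φ s : ℂ) = s + Complex.I * τ) : IsWienerDirichlet (f ∘ φ) := by
  obtain ⟨a, ha, hfa⟩ := hf
  refine ⟨fun n => a n * (n : ℂ) ^ (-(Complex.I * τ)), ?_, fun s => ?_⟩
  · refine (summable_nat_add_iff 1).1 (((summable_nat_add_iff 1).2 ha).congr fun n => ?_)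
    rw [norm_mul, Complex.norm_natCast_cpow_of_pos n.succ_pos]
    simp
  · rw [LSeries_mul_cpow_neg, Function.comp, hfa, hφ]

theorem CompositionIsAutomorphism.of_translation {φ : rightHalfPlane → rightHalfPlane} {τ : ℝ}
    (hφ : ∀ s, (φ s : ℂ) = s + Complex.I * τ) : CompositionIsAutomorphism φ := by
  let ψ : rightHalfPlane → rightHalfPlane := fun s =>
    ⟨s + Complex.I * (-τ : ℝ), by simpa [rightHalfPlane] using s.2⟩
  have hψ : ∀ s, (ψ s : ℂ) = s + Complex.I * (-τ : ℝ) := fun _ => rfl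
  have hψφ : ∀ s, ψ (φ s) = s := fun s => Subtype.ext (by rw [hψ, hφ]; push_cast; ring)
  have hφψ : ∀ s, φ (ψ s) = s := fun s => Subtype.ext (by rw [hφ, hψ]; push_cast; ring)
  exact ⟨{
    toFun := fun f => ⟨(f : rightHalfPlane → ℂ) ∘ φ, f.2.comp_translation hφ⟩
    invFun := fun f => ⟨(f : rightHalfPlane → ℂ) ∘ ψ, f.2.comp_translation hψ⟩
    left_inv := fun f => Subtype.ext (funext fun s => congrArg f.1 (hφψ s))
    right_inv := fun f => Subtype.ext (funext fun s => congrArg f.1 (hψφ s))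
    map_mul' := fun _ _ => rfl
    map_add' := fun _ _ => rfl
    commutes' := fun _ => rfl }, fun _ => rfl⟩

variable {φ : rightHalfPlane → rightHalfPlane}

theorem CompositionIsAutomorphism.exists_natCast_cpow_neg_eq_LSeries
    (h : CompositionIsAutomorphism φ) (n : ℕ) :
    ∃ a : ℕ → ℂ, Summable (fun k => ‖a k‖) ∧
      ∀ s : rightHalfPlane, (n : ℂ) ^ (-(φ s : ℂ)) = LSeries a s := by
  obtain ⟨T, hT⟩ := h
  obtain ⟨a, ha, hTa⟩ := (T (natCastCpowNeg n)).2
  exact ⟨a, ha, fun s => by rw [← hTa, hT]; rfl⟩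

theorem CompositionIsAutomorphism.exists_LSeries_comp_eq_natCast_cpow_neg
    (h : CompositionIsAutomorphism φ) {n : ℕ} (hn : 1 < n) :
    ∃ b : ℕ → ℂ, Summable (fun k => ‖b k‖) ∧ (∀ s : rightHalfPlane, ‖LSeries b s‖ ≤ 1) ∧
      ∀ s : rightHalfPlane, LSeries b (φ s) = (n : ℂ) ^ (-(s : ℂ)) := by
  obtain ⟨T, hT⟩ := h
  obtain ⟨b, hb, hTb⟩ := (T.symm (natCastCpowNeg n)).2
  refine ⟨b, hb, fun s => ?_, fun s => ?_⟩
  · rw [← hTb]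
    exact norm_algHom_natCastCpowNeg_le_one hn
      (((Pi.evalAlgHom ℂ (fun _ : rightHalfPlane => ℂ) s).comp wienerDirichletAlgebra.val).comp
        (T.symm : wienerDirichletAlgebra →ₐ[ℂ] wienerDirichletAlgebra))
  · have hs := congrFun (hT (T.symm (natCastCpowNeg n))) s
    rw [AlgEquiv.apply_symm_apply, Function.comp, hTb] at hs
    exact hs.symm

end CompositionOperator

theorem CompositionIsAutomorphism.exists_eq_add_I_mul {φ : ℂ → ℂ}
    {hmaps : Set.MapsTo φ rightHalfPlane rightHalfPlane}
    (h : CompositionIsAutomorphism (hmaps.restrict φ rightHalfPlane rightHalfPlane))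
    (hφ : AnalyticOnNhd ℂ φ rightHalfPlane) :
    ∃ τ : ℝ, ∀ s ∈ rightHalfPlane, φ s = s + Complex.I * τ := by
  obtain ⟨a, ha, hφa⟩ := h.exists_natCast_cpow_neg_eq_LSeries 2
  obtain ⟨b, hb, hb1, hbφ⟩ := h.exists_LSeries_comp_eq_natCast_cpow_neg one_lt_two
  obtain ⟨d, hd, -, hdφ⟩ := h.exists_LSeries_comp_eq_natCast_cpow_neg (n := 3) (by norm_num)
  simp only [Subtype.forall, Set.MapsTo.val_restrict_apply] at hφa hb1 hbφ hdφ
  have hlt : ∀ s ∈ rightHalfPlane, ‖LSeries a s‖ < 1 := fun s hs => by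
    rw [← hφa s hs]
    exact norm_natCast_cpow_neg_lt_one one_lt_two (hmaps hs)
  have ha1_lt : ‖a 1‖ < 1 := norm_lt_one_of_tendsto_mul_norm_sub
    (analyticOnNhd_LSeries_rightHalfPlane ha).differentiableOn hlt
    (tendsto_mul_norm_LSeries_sub_coeff_one ha)
  have hlim : Tendsto (fun x : ℝ => (2 : ℂ) ^ (-φ x)) atTop (𝓝 (a 1)) :=
    (tendsto_LSeries_coeff_one ha (u := fun x : ℝ => (x : ℂ)) tendsto_id).congr'
      (eventually_ofReal_mem_rightHalfPlane.mono fun x hx => by exact_mod_cast (hφa x hx).symm)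
  have ha1 : a 1 = 0 := eq_zero_of_tendsto_two_cpow_neg hφ.continuousOn
    (analyticOnNhd_LSeries_rightHalfPlane hb) (analyticOnNhd_LSeries_rightHalfPlane hd)
    one_lt_two (by norm_num) (by norm_num) hbφ hdφ ha1_lt hlim
  have hle : ∀ s ∈ rightHalfPlane, s.re ≤ (φ s).re := fun s hs =>
    re_le_re_of_two_cpow_neg_eq_LSeries hmaps ha ha1 (by exact_mod_cast hφa) hs
  exact exists_eq_add_I_mul_of_re_eq hφ fun s hs => le_antisymm
    (re_le_re_of_LSeries_comp_eq_two_cpow_neg hmaps hb hb1 (by exact_mod_cast hbφ) hle hs)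
    (hle s hs)

theorem theorem3p4 (φ : ℂ → ℂ) (hmaps : Set.MapsTo φ rightHalfPlane rightHalfPlane)
    (hφ : AnalyticOnNhd ℂ φ rightHalfPlane) :
    CompositionIsAutomorphism (hmaps.restrict φ rightHalfPlane rightHalfPlane) ↔
      ∃ τ : ℝ, ∀ s ∈ rightHalfPlane, φ s = s + Complex.I * (τ : ℂ) :=
  ⟨fun h => h.exists_eq_add_I_mul hφ, fun ⟨_, hτ⟩ => .of_translation fun s => hτ s s.2⟩
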